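/- Let $d,n\ge 1$ be integers and let $d\mu(x)=(2\pi)^{-d/2}e^{-|x|^2/2}\,dx$ be the standard Gaussian measure on $\mathbb R^d$. For $k=(k_1,\dots,k_d)\in\mathbb N^d$ write $|k|=\sum_j k_j$ and let $H_k(x)=\prod_{j=1}^d h_{k_j}(x_j)$ be the normalized tensor Hermite polynomials, where $h_m(y)=(-1)^m (m!)^{-1/2}e^{y^2/2}\frac{d^m}{dy^m}\big(e^{-y^2/2}\big)$. Let $w\in L^2(\mathbb R^d,d\mu)$ be real-valued with $\int w\,d\mu=1$ and $\int w\,H_k\,d\mu=0$ for all $k\in\mathbb N^d$ with $0<|k|<n$. Then $$\|w-1\|_{L^2(d\mu)}^2\le \frac1n\,\|\nabla w\|_{L^2(d\mu)}^2,$$ where $\nabla w$ is the weak gradient and the right-hand side is understood as $+\infty$ if $w$ has no weak gradient in $L^2(d\mu)$. The constant $1/n$ is optimal: it is the smallest constant $C\ge 0$ such that $\|w-1\|_{L^2(d\mu)}^2\le C\,\|\nabla w\|_{L^2(d\mu)}^2$ for all such $w$. -/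

import Mathlib

open MeasureTheory
open scoped ENNReal NNReal ContDiff

noncomputable section

/-- The Gaussian measure `dμ = (2π)^(-d/2) exp(-|x|²/2) dx` on `ℝ^d`. -/
def gaussianMeasure (d : ℕ) : Measure (EuclideanSpace ℝ (Fin d)) :=
  volume.withDensity fun x =>
    ENNReal.ofReal ((2 * Real.pi) ^ (-(d : ℝ) / 2) * Real.exp (-‖x‖ ^ 2 / 2))

/-- The normalized Hermite polynomial
`h_m(y) = (-1)^m (m!)^(-1/2) exp(y²/2) (d/dy)^m exp(-y²/2)`. -/
def hermiteFun (m : ℕ) (y : ℝ) : ℝ :=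
  (-1) ^ m * (Real.sqrt (m.factorial : ℝ))⁻¹ * Real.exp (y ^ 2 / 2) *
    iteratedDeriv m (fun z : ℝ => Real.exp (-z ^ 2 / 2)) y

/-- The tensor Hermite polynomial `H_k(x) = ∏ j, h_{k_j}(x_j)`. -/
def hermiteTensor {d : ℕ} (k : Fin d → ℕ) (x : EuclideanSpace ℝ (Fin d)) : ℝ :=
  ∏ j, hermiteFun (k j) (x j)

/-- `g` is the weak (distributional) gradient of `w` on `ℝ^d`: both are locally integrable for
Lebesgue measure, and `∫ w ∂ᵢφ dx = -∫ gᵢ φ dx` for all test functions `φ ∈ C_c^∞(ℝ^d)`. -/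
structure HasWeakGradient {d : ℕ} (w : EuclideanSpace ℝ (Fin d) → ℝ)
    (g : EuclideanSpace ℝ (Fin d) → EuclideanSpace ℝ (Fin d)) : Prop where
  locallyIntegrable : LocallyIntegrable w volume
  locallyIntegrable_grad : LocallyIntegrable g volume
  integral_eq : ∀ φ : EuclideanSpace ℝ (Fin d) → ℝ, ContDiff ℝ ∞ φ → HasCompactSupport φ →
    ∀ i : Fin d, ∫ x, w x * fderiv ℝ φ x (EuclideanSpace.single i 1) = -∫ x, g x i * φ x

end

/-!
The Hermite tensors `H_k` form an orthonormal basis of `L²(μ)`. Integrating by parts against the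
Gaussian density, with `x_i H_k - ∂_i H_k = √(k_i + 1) H_{k + e_i}`, shows that the coefficient of
`∂_i w` along `H_k` is `√(k_i + 1) c_{k + e_i}`, where `c_k` are the coefficients of `w`. By
Parseval, `‖∇w‖² = ∑ |k| c_k²`, while `‖w - 1‖² = ∑_{k ≠ 0} c_k²`, and only the `k` with `|k| ≥ n`
contribute. Equality holds for `w = 1 + H_k` with `|k| = n`.

Completeness of the Hermite tensors: if `f ∈ L²(μ)` has vanishing coefficients, the three-term
recurrence gives `∫ f ⟨x, ξ⟩ⁿ dμ = 0` for all `n`. The exponential integrability of `μ` allows the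
summation of these moments to `∫ f exp(i⟨x, ξ⟩) dμ = 0`, and `f = 0` by uniqueness of
characteristic functions.
-/

open Filter Polynomial ProbabilityTheory Topology

section HermitePolynomials

theorem derivative_hermite_succ (n : ℕ) :
    derivative (hermite (n + 1)) = ((n : ℤ[X]) + 1) * hermite n := by
  induction n with
  | zero => simp
  | succ n ih =>
    have hconst : derivative ((n : ℤ[X]) + 1) = 0 := by simp
    rw [hermite_succ (n + 1), derivative_sub, derivative_mul, derivative_X, ih, derivative_mul,
      hconst, hermite_succ n]
    push_cast
    ring

theorem hasTemperateGrowth_aeval {R : Type*} [CommSemiring R] [Algebra R ℝ] (p : R[X]) :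
    (fun y : ℝ => aeval y p).HasTemperateGrowth := by
  simp only [aeval_eq_sum_range, Algebra.smul_def]
  fun_prop

theorem hermiteFun_eq_aeval (m : ℕ) (y : ℝ) :
    hermiteFun m y = (√(m.factorial : ℝ))⁻¹ * aeval y (hermite m) := by
  rw [hermite_eq_deriv_gaussian', hermiteFun, iteratedDeriv_eq_iterate]
  simp only [neg_div]
  ring

theorem hermiteFun_zero (y : ℝ) : hermiteFun 0 y = 1 := by
  simp [hermiteFun_eq_aeval]

theorem hasTemperateGrowth_hermiteFun (m : ℕ) : (hermiteFun m).HasTemperateGrowth := by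
  rw [funext (hermiteFun_eq_aeval m)]
  exact (Function.HasTemperateGrowth.const _).mul (hasTemperateGrowth_aeval _)

theorem sqrt_succ_factorial (m : ℕ) :
    √((m + 1).factorial : ℝ) = √((m : ℝ) + 1) * √(m.factorial : ℝ) := by
  rw [Nat.factorial_succ, Nat.cast_mul, Real.sqrt_mul (by positivity), Nat.cast_succ]

-- At `m = 0` the truncated `m - 1` is harmless, because its coefficient `√m` vanishes.
theorem hasDerivAt_hermiteFun (m : ℕ) (y : ℝ) :
    HasDerivAt (hermiteFun m) (√(m : ℝ) * hermiteFun (m - 1) y) y := by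
  cases m with
  | zero => simpa [funext hermiteFun_zero] using hasDerivAt_const y (1 : ℝ)
  | succ m =>
    rw [funext (hermiteFun_eq_aeval (m + 1))]
    refine (((hermite (m + 1)).hasDerivAt_aeval y).const_mul _).congr_deriv ?_
    have hsq : √((m : ℝ) + 1) ^ 2 = m + 1 := Real.sq_sqrt (by positivity)
    rw [derivative_hermite_succ, hermiteFun_eq_aeval, sqrt_succ_factorial]
    simp only [Nat.add_sub_cancel, map_mul, map_add, map_natCast, map_one, Nat.cast_succ]
    field_simp
    rw [hsq]

theorem sqrt_mul_hermiteFun_succ (m : ℕ) (y : ℝ) :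
    √((m : ℝ) + 1) * hermiteFun (m + 1) y =
      y * hermiteFun m y - √(m : ℝ) * hermiteFun (m - 1) y := by
  have hderiv : √(m : ℝ) * hermiteFun (m - 1) y =
      (√(m.factorial : ℝ))⁻¹ * aeval y (derivative (hermite m)) := by
    refine (hasDerivAt_hermiteFun m y).unique ?_
    rw [funext (hermiteFun_eq_aeval m)]
    exact ((hermite m).hasDerivAt_aeval y).const_mul _
  rw [hderiv, hermiteFun_eq_aeval, hermiteFun_eq_aeval, hermite_succ, sqrt_succ_factorial]
  simp only [map_sub, map_mul, aeval_X]
  field_simp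

variable {d : ℕ}

theorem hermiteTensor_eq_mul_prod_erase {k l : Fin d → ℕ} {i : Fin d} (h : ∀ j ≠ i, l j = k j)
    (x : EuclideanSpace ℝ (Fin d)) :
    hermiteTensor l x =
      hermiteFun (l i) (x i) * ∏ j ∈ Finset.univ.erase i, hermiteFun (k j) (x j) := by
  rw [hermiteTensor, ← Finset.mul_prod_erase _ _ (Finset.mem_univ i)]
  congr 1
  exact Finset.prod_congr rfl fun j hj => by rw [h j (Finset.ne_of_mem_erase hj)]

theorem hermiteTensor_zero : hermiteTensor (0 : Fin d → ℕ) = fun _ => 1 := by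
  funext x
  simp [hermiteTensor, hermiteFun_zero]

theorem hasTemperateGrowth_hermiteTensor (k : Fin d → ℕ) :
    (hermiteTensor k).HasTemperateGrowth := by
  suffices ∀ s : Finset (Fin d), (fun x : EuclideanSpace ℝ (Fin d) =>
      ∏ j ∈ s, hermiteFun (k j) (x j)).HasTemperateGrowth from this Finset.univ
  intro s
  induction s using Finset.induction_on with
  | empty => simp
  | insert j s hj ih =>
    simp only [Finset.prod_insert hj]
    have hcoord := (EuclideanSpace.proj (𝕜 := ℝ) j).hasTemperateGrowth
    exact ((hasTemperateGrowth_hermiteFun (k j)).comp hcoord).fun_mul ih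

theorem contDiff_hermiteTensor (k : Fin d → ℕ) : ContDiff ℝ ∞ (hermiteTensor k) :=
  (hasTemperateGrowth_hermiteTensor k).1

theorem fderiv_hermiteTensor_single (k : Fin d → ℕ) (i : Fin d) (x : EuclideanSpace ℝ (Fin d)) :
    fderiv ℝ (hermiteTensor k) x (EuclideanSpace.single i 1) =
      √(k i : ℝ) * hermiteTensor (k - Pi.single i 1) x := by
  have hline (t : ℝ) : hermiteTensor k (x + t • EuclideanSpace.single i 1) =
      hermiteFun (k i) (x i + t) * ∏ j ∈ Finset.univ.erase i, hermiteFun (k j) (x j) := by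
    rw [hermiteTensor_eq_mul_prod_erase (k := k) (i := i) fun _ _ => rfl]
    congr 1
    · simp
    · exact Finset.prod_congr rfl fun j hj => by simp [Finset.ne_of_mem_erase hj]
  rw [← ((contDiff_hermiteTensor k).differentiable (by simp) x).lineDeriv_eq_fderiv]
  refine HasLineDerivAt.lineDeriv ?_
  rw [HasLineDerivAt, funext hline, hermiteTensor_eq_mul_prod_erase (k := k) (i := i)
    (fun j hj => by simp [hj]), ← mul_assoc, Pi.sub_apply, Pi.single_eq_same]
  refine HasDerivAt.mul_const (HasDerivAt.comp_const_add (x i) 0 ?_) _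
  simpa using hasDerivAt_hermiteFun (k i) (x i)

theorem sqrt_mul_hermiteTensor_add_single (k : Fin d → ℕ) (i : Fin d)
    (x : EuclideanSpace ℝ (Fin d)) :
    √((k i : ℝ) + 1) * hermiteTensor (k + Pi.single i 1) x =
      x i * hermiteTensor k x - √(k i : ℝ) * hermiteTensor (k - Pi.single i 1) x := by
  have hoff : ∀ j ≠ i, (k + Pi.single i 1 : Fin d → ℕ) j = k j ∧
      (k - Pi.single i 1 : Fin d → ℕ) j = k j := by
    intro j hj
    simp [hj]
  rw [hermiteTensor_eq_mul_prod_erase fun j hj => (hoff j hj).1,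
    hermiteTensor_eq_mul_prod_erase fun j hj => (hoff j hj).2,
    hermiteTensor_eq_mul_prod_erase (k := k) (l := k) (i := i) fun _ _ => rfl]
  simp only [Pi.add_apply, Pi.sub_apply, Pi.single_eq_same, ← mul_assoc, sqrt_mul_hermiteFun_succ]
  ring

end HermitePolynomials

section GaussianMeasure

variable {d : ℕ}

/-- The density of `gaussianMeasure d` with respect to Lebesgue measure, as a real function, so
that it can serve as a factor of test functions. -/
noncomputable def gaussianDensity (d : ℕ) (x : EuclideanSpace ℝ (Fin d)) : ℝ :=
  (2 * Real.pi) ^ (-(d : ℝ) / 2) * Real.exp (-‖x‖ ^ 2 / 2)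

theorem gaussianDensity_pos (x : EuclideanSpace ℝ (Fin d)) : 0 < gaussianDensity d x := by
  unfold gaussianDensity
  positivity

theorem contDiff_gaussianDensity : ContDiff ℝ ∞ (gaussianDensity d) :=
  contDiff_const.mul (((contDiff_norm_sq ℝ).neg.div_const 2).exp)

theorem fderiv_gaussianDensity_single (x : EuclideanSpace ℝ (Fin d)) (i : Fin d) :
    fderiv ℝ (gaussianDensity d) x (EuclideanSpace.single i 1) = -(x i * gaussianDensity d x) := by
  have h : HasFDerivAt (gaussianDensity d) _ x :=
    ((hasStrictFDerivAt_norm_sq x).hasFDerivAt.neg.mul_const (2⁻¹ : ℝ)).exp.const_mul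
      ((2 * Real.pi) ^ (-(d : ℝ) / 2))
  rw [h.fderiv, gaussianDensity]
  simp only [neg_apply, smul_apply, coe_innerSL_apply, EuclideanSpace.inner_single_right,
    Real.ringHom_apply, Pi.neg_apply, smul_eq_mul, nsmul_eq_mul, Nat.cast_ofNat, div_eq_mul_inv]
  ring

theorem measurable_ofReal_gaussianDensity :
    Measurable fun x => ENNReal.ofReal (gaussianDensity d x) :=
  contDiff_gaussianDensity.continuous.measurable.ennreal_ofReal

theorem integral_gaussianMeasure {E : Type*} [NormedAddCommGroup E] [NormedSpace ℝ E]
    (f : EuclideanSpace ℝ (Fin d) → E) :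
    ∫ x, f x ∂(gaussianMeasure d) = ∫ x, gaussianDensity d x • f x := by
  refine (integral_withDensity_eq_integral_toReal_smul measurable_ofReal_gaussianDensity
    (.of_forall fun _ => ENNReal.ofReal_lt_top) f).trans ?_
  simp only [ENNReal.toReal_ofReal (gaussianDensity_pos _).le]

theorem integrable_gaussianMeasure_iff {f : EuclideanSpace ℝ (Fin d) → ℝ} :
    Integrable f (gaussianMeasure d) ↔ Integrable fun x => gaussianDensity d x * f x := by
  refine (integrable_withDensity_iff_integrable_smul' measurable_ofReal_gaussianDensity
    (.of_forall fun _ => ENNReal.ofReal_lt_top)).trans ?_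
  simp only [ENNReal.toReal_ofReal (gaussianDensity_pos _).le, smul_eq_mul]

theorem gaussianMeasure_absolutelyContinuous : gaussianMeasure d ≪ volume :=
  withDensity_absolutelyContinuous _ _

theorem integrable_gaussianDensity : Integrable (gaussianDensity d) := by
  have h := (GaussianFourier.integrable_cexp_neg_mul_sq_norm_add
    (V := EuclideanSpace ℝ (Fin d)) (b := 1 / 2) (by norm_num) 0 0).norm
  refine (h.const_mul ((2 * Real.pi) ^ (-(d : ℝ) / 2))).congr (.of_forall fun x => ?_)
  have hexp : -(1 / 2) * (‖x‖ : ℂ) ^ 2 + 0 * (inner ℝ 0 x : ℝ) = ((-‖x‖ ^ 2 / 2 : ℝ) : ℂ) := by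
    push_cast
    ring
  simp only [Complex.norm_exp, hexp, Complex.ofReal_re, gaussianDensity]

theorem charFun_gaussianMeasure (t : EuclideanSpace ℝ (Fin d)) :
    charFun (gaussianMeasure d) t = Complex.exp (-‖t‖ ^ 2 / 2) := by
  have hpi : (2 * Real.pi : ℂ) ≠ 0 := by exact_mod_cast Real.two_pi_pos.ne'
  have hint := GaussianFourier.integral_cexp_neg_mul_sq_norm_add (b := 1 / 2) (by norm_num)
    Complex.I t
  rw [charFun_apply, integral_gaussianMeasure]
  calc ∫ x, gaussianDensity d x • Complex.exp (inner ℝ x t * Complex.I)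
      = ∫ x, ((2 * Real.pi) ^ (-(d : ℂ) / 2) : ℂ) *
          Complex.exp (-(1 / 2) * ‖x‖ ^ 2 + Complex.I * inner ℝ t x) := by
        refine integral_congr_ae (.of_forall fun x => ?_)
        simp only [gaussianDensity, Complex.real_smul, real_inner_comm t x, Complex.exp_add]
        push_cast [Complex.ofReal_cpow Real.two_pi_pos.le]
        ring_nf
    _ = Complex.exp (-‖t‖ ^ 2 / 2) := by
        rw [integral_const_mul, hint, finrank_euclideanSpace_fin, ← mul_assoc, div_div_eq_mul_div,
          div_one, mul_comm (Real.pi : ℂ), ← Complex.cpow_add _ _ hpi, neg_div,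
          neg_add_cancel, Complex.cpow_zero, one_mul, Complex.I_sq]
        ring_nf

theorem gaussianMeasure_eq_stdGaussian :
    gaussianMeasure d = stdGaussian (EuclideanSpace ℝ (Fin d)) := by
  have : IsFiniteMeasure (gaussianMeasure d) :=
    isFiniteMeasure_withDensity_ofReal integrable_gaussianDensity.2
  refine Measure.ext_of_charFun (funext fun t => ?_)
  rw [charFun_gaussianMeasure, charFun_stdGaussian]

instance isGaussian_gaussianMeasure : IsGaussian (gaussianMeasure d) := by
  rw [gaussianMeasure_eq_stdGaussian]
  infer_instance

end GaussianMeasure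

section GaussianIntegrability

variable {E : Type*} [NormedAddCommGroup E] [NormedSpace ℝ E] [MeasurableSpace E] [BorelSpace E]
  {μ : Measure E} [IsGaussian μ]

theorem memLp_of_hasTemperateGrowth [CompleteSpace E] [SecondCountableTopology E] {F : Type*}
    [NormedAddCommGroup F] [NormedSpace ℝ F] {f : E → F} (hf : f.HasTemperateGrowth) {p : ℝ≥0∞}
    (hp : p ≠ ⊤) : MemLp f p μ := by
  obtain ⟨k, C, hC⟩ := hf.2 0
  have hpk : p * k ≠ ⊤ := ENNReal.mul_ne_top hp (ENNReal.natCast_ne_top k)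
  have hnorm : MemLp (fun x : E => ‖x‖) (p * k) μ := (IsGaussian.memLp_id μ (p * k) hpk).norm
  have hbase : MemLp (fun x : E => 1 + ‖x‖) (p * k) μ := (memLp_const (1 : ℝ)).add hnorm
  have hpow : MemLp (fun x : E => (1 + ‖x‖) ^ k) p μ := by
    rcases eq_or_ne k 0 with rfl | hk
    · simpa using memLp_const (1 : ℝ)
    · have h := hbase.norm_rpow_div k
      rw [ENNReal.mul_div_cancel_right (by simpa using hk) (by simp)] at h
      refine h.ae_eq (.of_forall fun x => ?_)
      simp only [ENNReal.toReal_natCast, Real.rpow_natCast]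
      rw [Real.norm_of_nonneg (by positivity)]
  refine (hpow.const_mul C).mono' hf.1.continuous.aestronglyMeasurable (.of_forall fun x => ?_)
  simpa only [norm_iteratedFDeriv_zero] using hC x

theorem integrable_exp_mul_strongDual (L : StrongDual ℝ E) (t : ℝ) :
    Integrable (fun x => Real.exp (t * L x)) μ := by
  have h := integrable_exp_mul_gaussianReal (μ := ∫ x, L x ∂μ) (v := Var[L; μ].toNNReal) t
  rw [← IsGaussian.map_eq_gaussianReal] at h
  exact h.comp_measurable L.measurable

theorem memLp_two_exp_abs_strongDual (L : StrongDual ℝ E) :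
    MemLp (fun x => Real.exp |L x|) 2 μ := by
  rw [memLp_two_iff_integrable_sq (by fun_prop)]
  simp only [← Real.exp_nat_mul]
  exact integrable_exp_mul_abs (integrable_exp_mul_strongDual L _)
    (integrable_exp_mul_strongDual L _)

end GaussianIntegrability

section SmoothCutoff

variable {E : Type*} [NormedAddCommGroup E] [NormedSpace ℝ E] [HasContDiffBump E]

/-- Smooth compactly supported approximations of the constant function `1`, by which integrable
functions are truncated: `smoothCutoff m` is a bump function scaled so as to equal `1` on the ball
of radius `m + 1`, and its derivative is of order `1 / (m + 1)`. -/
noncomputable def smoothCutoff (m : ℕ) (x : E) : ℝ :=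
  (⟨1, 2, one_pos, one_lt_two⟩ : ContDiffBump (0 : E)) (((m : ℝ) + 1)⁻¹ • x)

theorem contDiff_smoothCutoff (m : ℕ) : ContDiff ℝ ∞ (smoothCutoff (E := E) m) :=
  (ContDiffBump.contDiff _).comp (contDiff_const_smul _)

theorem norm_smoothCutoff_le_one (m : ℕ) (x : E) : ‖smoothCutoff m x‖ ≤ 1 := by
  rw [smoothCutoff, Real.norm_of_nonneg (ContDiffBump.nonneg _)]
  exact ContDiffBump.le_one _

theorem tendsto_smoothCutoff (x : E) : Tendsto (fun m => smoothCutoff m x) atTop (𝓝 1) := by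
  let f : ContDiffBump (0 : E) := ⟨1, 2, one_pos, one_lt_two⟩
  have hone : f 0 = 1 := f.one_of_mem_closedBall (by simp [f])
  have hscale : Tendsto (fun m : ℕ => ((m : ℝ) + 1)⁻¹ • x) atTop (𝓝 0) := by
    simpa using (tendsto_one_div_add_atTop_nhds_zero_nat (𝕜 := ℝ)).smul_const x
  rw [← hone]
  exact (f.continuous.tendsto 0).comp hscale

theorem hasCompactSupport_smoothCutoff [FiniteDimensional ℝ E] (m : ℕ) :
    HasCompactSupport (smoothCutoff (E := E) m) :=
  (ContDiffBump.hasCompactSupport _).comp_smul (by positivity)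

theorem exists_norm_fderiv_smoothCutoff_le [FiniteDimensional ℝ E] :
    ∃ M, ∀ (m : ℕ) (x : E), ‖fderiv ℝ (smoothCutoff m) x‖ ≤ ((m : ℝ) + 1)⁻¹ * M := by
  let f : ContDiffBump (0 : E) := ⟨1, 2, one_pos, one_lt_two⟩
  obtain ⟨M, hM⟩ := (f.contDiff.continuous_fderiv one_ne_zero).bounded_above_of_compact_support
    (f.hasCompactSupport.fderiv ℝ)
  refine ⟨M, fun m x => ?_⟩
  calc ‖fderiv ℝ (smoothCutoff m) x‖ = ‖((m : ℝ) + 1)⁻¹ • fderiv ℝ f (((m : ℝ) + 1)⁻¹ • x)‖ :=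
        congrArg norm (fderiv_comp_smul _)
    _ ≤ ((m : ℝ) + 1)⁻¹ * M := by
        rw [norm_smul, Real.norm_of_nonneg (by positivity)]
        gcongr
        exact hM _

variable [MeasurableSpace E] {μ : Measure E} {f : E → ℝ}

theorem integrable_mul_smoothCutoff [BorelSpace E] (hf : Integrable f μ) (m : ℕ) :
    Integrable (fun x => f x * smoothCutoff m x) μ :=
  hf.mul_bdd (c := 1) (contDiff_smoothCutoff m).continuous.aestronglyMeasurable
    (.of_forall (norm_smoothCutoff_le_one m))

theorem tendsto_integral_mul_smoothCutoff [BorelSpace E] (hf : Integrable f μ) :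
    Tendsto (fun m => ∫ x, f x * smoothCutoff m x ∂μ) atTop (𝓝 (∫ x, f x ∂μ)) := by
  refine tendsto_integral_of_dominated_convergence (fun x => ‖f x‖)
    (fun m => (integrable_mul_smoothCutoff hf m).aestronglyMeasurable) hf.norm
    (fun m => .of_forall fun x => ?_) (.of_forall fun x => ?_)
  · rw [norm_mul]
    exact mul_le_of_le_one_right (norm_nonneg _) (norm_smoothCutoff_le_one m x)
  · simpa using (tendsto_smoothCutoff x).const_mul (f x)

theorem integrable_mul_fderiv_smoothCutoff [BorelSpace E] [FiniteDimensional ℝ E]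
    (hf : Integrable f μ) (m : ℕ) (v : E) :
    Integrable (fun x => f x * fderiv ℝ (smoothCutoff m) x v) μ := by
  have hcont : Continuous fun x : E => fderiv ℝ (smoothCutoff m) x v :=
    ((contDiff_smoothCutoff m).continuous_fderiv (by simp)).clm_apply continuous_const
  obtain ⟨M, hM⟩ := hcont.bounded_above_of_compact_support
    ((hasCompactSupport_smoothCutoff m).fderiv_apply ℝ v)
  exact hf.mul_bdd (c := M) hcont.aestronglyMeasurable (.of_forall hM)

theorem tendsto_integral_mul_fderiv_smoothCutoff [FiniteDimensional ℝ E] (hf : Integrable f μ)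
    (v : E) :
    Tendsto (fun m => ∫ x, f x * fderiv ℝ (smoothCutoff m) x v ∂μ) atTop (𝓝 0) := by
  obtain ⟨M, hM⟩ := exists_norm_fderiv_smoothCutoff_le (E := E)
  refine squeeze_zero_norm (a := fun m : ℕ => (1 / ((m : ℝ) + 1)) * ∫ x, ‖f x‖ * (M * ‖v‖) ∂μ)
    (fun m => ?_) ?_
  · rw [← integral_const_mul]
    refine norm_integral_le_of_norm_le ((hf.norm.mul_const _).const_mul _)
      (.of_forall fun x => ?_)
    calc ‖f x * fderiv ℝ (smoothCutoff m) x v‖ ≤ ‖f x‖ * (((m : ℝ) + 1)⁻¹ * M * ‖v‖) := by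
          rw [norm_mul]
          gcongr
          exact (fderiv ℝ (smoothCutoff m) x).le_of_opNorm_le (hM m x) v
      _ = 1 / ((m : ℝ) + 1) * (‖f x‖ * (M * ‖v‖)) := by ring
  · simpa using (tendsto_one_div_add_atTop_nhds_zero_nat (𝕜 := ℝ)).mul_const _

end SmoothCutoff

section WeakGradient

variable {d : ℕ} {w : EuclideanSpace ℝ (Fin d) → ℝ}
  {g : EuclideanSpace ℝ (Fin d) → EuclideanSpace ℝ (Fin d)}

theorem HasWeakGradient.integral_mul_fderiv_of_integrable (h : HasWeakGradient w g)
    {ψ : EuclideanSpace ℝ (Fin d) → ℝ} (hψ : ContDiff ℝ ∞ ψ) (i : Fin d)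
    (hwψ : Integrable fun x => w x * ψ x)
    (hwdψ : Integrable fun x => w x * fderiv ℝ ψ x (EuclideanSpace.single i 1))
    (hgψ : Integrable fun x => g x i * ψ x) :
    ∫ x, w x * fderiv ℝ ψ x (EuclideanSpace.single i 1) = -∫ x, g x i * ψ x := by
  set e : EuclideanSpace ℝ (Fin d) := EuclideanSpace.single i 1
  have htest (m : ℕ) : (∫ x, w x * fderiv ℝ ψ x e * smoothCutoff m x) +
      ∫ x, w x * ψ x * fderiv ℝ (smoothCutoff m) x e = -∫ x, g x i * ψ x * smoothCutoff m x := by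
    have hχ := contDiff_smoothCutoff (E := EuclideanSpace ℝ (Fin d)) m
    simp only [mul_assoc (g _ i)]
    rw [← h.integral_eq _ (hψ.mul hχ) (hasCompactSupport_smoothCutoff m).mul_left i,
      ← integral_add (integrable_mul_smoothCutoff hwdψ m)
        (integrable_mul_fderiv_smoothCutoff hwψ m e)]
    refine integral_congr_ae (.of_forall fun x => ?_)
    simp only [fderiv_fun_mul (hψ.differentiable (by simp) x) (hχ.differentiable (by simp) x),
      add_apply, smul_apply, smul_eq_mul]
    ring
  have hlim := (tendsto_integral_mul_smoothCutoff hwdψ).add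
    (tendsto_integral_mul_fderiv_smoothCutoff hwψ e)
  simp only [htest, add_zero] at hlim
  exact tendsto_nhds_unique hlim (tendsto_integral_mul_smoothCutoff hgψ).neg

theorem HasWeakGradient.integral_grad_mul_gaussianMeasure (h : HasWeakGradient w g)
    {v : EuclideanSpace ℝ (Fin d) → ℝ} (hv : ContDiff ℝ ∞ v) (i : Fin d)
    (hwv : Integrable (fun x => w x * v x) (gaussianMeasure d))
    (hwdv : Integrable (fun x => w x * (x i * v x - fderiv ℝ v x (EuclideanSpace.single i 1)))
      (gaussianMeasure d))
    (hgv : Integrable (fun x => g x i * v x) (gaussianMeasure d)) :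
    ∫ x, g x i * v x ∂(gaussianMeasure d) =
      ∫ x, w x * (x i * v x - fderiv ℝ v x (EuclideanSpace.single i 1)) ∂(gaussianMeasure d) := by
  have hderiv (x : EuclideanSpace ℝ (Fin d)) :
      fderiv ℝ (fun y => gaussianDensity d y * v y) x (EuclideanSpace.single i 1) =
        -(gaussianDensity d x * (x i * v x - fderiv ℝ v x (EuclideanSpace.single i 1))) := by
    rw [fderiv_fun_mul (contDiff_gaussianDensity.differentiable (by simp) x)
      (hv.differentiable (by simp) x)]
    simp only [add_apply, smul_apply, smul_eq_mul, fderiv_gaussianDensity_single]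
    ring
  rw [integrable_gaussianMeasure_iff] at hwv hwdv hgv
  have hparts := h.integral_mul_fderiv_of_integrable (contDiff_gaussianDensity.mul hv) i
    (by simpa only [mul_left_comm] using hwv)
    (by simpa only [hderiv, mul_neg, mul_left_comm (w _)] using hwdv.fun_neg)
    (by simpa only [mul_left_comm] using hgv)
  simp only [hderiv, mul_neg, integral_neg, neg_inj, mul_left_comm (w _) (gaussianDensity d _),
    mul_left_comm (g _ i) (gaussianDensity d _)] at hparts
  simp only [integral_gaussianMeasure, smul_eq_mul, hparts]

theorem gradient_apply (f : EuclideanSpace ℝ (Fin d) → ℝ) (x : EuclideanSpace ℝ (Fin d))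
    (i : Fin d) : gradient f x i = fderiv ℝ f x (EuclideanSpace.single i 1) := by
  rw [← inner_gradient_left, EuclideanSpace.inner_single_right]
  simp

theorem HasWeakGradient.of_contDiff (hw : ContDiff ℝ 1 w) : HasWeakGradient w (gradient w) where
  locallyIntegrable := hw.continuous.locallyIntegrable
  locallyIntegrable_grad :=
    ((InnerProductSpace.toDual ℝ _).symm.continuous.comp
      (hw.continuous_fderiv one_ne_zero)).locallyIntegrable
  integral_eq φ hφ hφc i := by
    simp only [gradient_apply]
    have hdw : Continuous fun x => fderiv ℝ w x (EuclideanSpace.single i 1) :=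
      (hw.continuous_fderiv one_ne_zero).clm_apply continuous_const
    have hdφ : Continuous fun x => fderiv ℝ φ x (EuclideanSpace.single i 1) :=
      (hφ.continuous_fderiv (by simp)).clm_apply continuous_const
    exact integral_mul_fderiv_eq_neg_fderiv_mul_of_integrable
      ((hdw.mul hφ.continuous).integrable_of_hasCompactSupport hφc.mul_left)
      ((hw.continuous.mul hdφ).integrable_of_hasCompactSupport (hφc.fderiv_apply ℝ _).mul_left)
      ((hw.continuous.mul hφ.continuous).integrable_of_hasCompactSupport hφc.mul_left)
      (fun x _ => hw.differentiable one_ne_zero x) (fun x _ => hφ.differentiable (by simp) x)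

end WeakGradient

section MultiIndex

variable {ι : Type*} [DecidableEq ι]

theorem exists_eq_add_single_of_ne_zero {k : ι → ℕ} {i : ι} (hk : k i ≠ 0) :
    ∃ m : ι → ℕ, k = m + Pi.single i 1 := by
  refine ⟨k - Pi.single i 1, (tsub_add_cancel_of_le fun j => ?_).symm⟩
  obtain rfl | hj := eq_or_ne j i
  · simpa using Nat.one_le_iff_ne_zero.2 hk
  · simp [hj]

theorem multiIndex_induction [Finite ι] {P : (ι → ℕ) → Prop} (zero : P 0)
    (add_single : ∀ (k : ι → ℕ) (i : ι), P k → P (k + Pi.single i 1)) (k : ι → ℕ) : P k := by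
  have := Fintype.ofFinite ι
  induction hN : ∑ i, k i generalizing k with
  | zero =>
    obtain rfl : k = 0 := funext fun i => by simpa using Finset.sum_eq_zero_iff.1 hN i
    exact zero
  | succ N ih =>
    obtain ⟨i, -, hi⟩ := Finset.exists_ne_zero_of_sum_ne_zero (hN.trans_ne N.succ_ne_zero)
    obtain ⟨m, rfl⟩ := exists_eq_add_single_of_ne_zero hi
    refine add_single m i (ih m ?_)
    simpa [Finset.sum_add_distrib] using hN

theorem tsum_add_single_eq_tsum {α : Type*} [AddCommMonoid α] [TopologicalSpace α] (i : ι)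
    {F : (ι → ℕ) → α} (hF : ∀ k, k i = 0 → F k = 0) :
    ∑' k : ι → ℕ, F (k + Pi.single i 1) = ∑' k, F k := by
  refine (add_left_injective (Pi.single i 1 : ι → ℕ)).tsum_eq fun k hk => ?_
  obtain ⟨m, rfl⟩ := exists_eq_add_single_of_ne_zero fun h => hk (hF k h)
  exact ⟨m, rfl⟩

end MultiIndex

section HermiteCoefficients

variable {d : ℕ} {w f : EuclideanSpace ℝ (Fin d) → ℝ}
  {g : EuclideanSpace ℝ (Fin d) → EuclideanSpace ℝ (Fin d)}

theorem memLp_hermiteTensor (k : Fin d → ℕ) : MemLp (hermiteTensor k) 2 (gaussianMeasure d) :=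
  memLp_of_hasTemperateGrowth (hasTemperateGrowth_hermiteTensor k) (by simp)

/-- The coefficient of `f` along `H_k` in the Hermite expansion of `L²` of the Gaussian measure. -/
noncomputable def hermiteCoeff (f : EuclideanSpace ℝ (Fin d) → ℝ) (k : Fin d → ℕ) : ℝ :=
  ∫ x, f x * hermiteTensor k x ∂(gaussianMeasure d)

theorem hermiteCoeff_zero_right (f : EuclideanSpace ℝ (Fin d) → ℝ) :
    hermiteCoeff f 0 = ∫ x, f x ∂(gaussianMeasure d) := by
  simp [hermiteCoeff, hermiteTensor_zero]

theorem HasWeakGradient.hermiteCoeff_grad (h : HasWeakGradient w g)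
    (hw : MemLp w 2 (gaussianMeasure d)) {i : Fin d}
    (hg : MemLp (fun x => g x i) 2 (gaussianMeasure d)) (k : Fin d → ℕ) :
    hermiteCoeff (fun x => g x i) k = √((k i : ℝ) + 1) * hermiteCoeff w (k + Pi.single i 1) := by
  have hraise (x : EuclideanSpace ℝ (Fin d)) :
      x i * hermiteTensor k x - fderiv ℝ (hermiteTensor k) x (EuclideanSpace.single i 1) =
        √((k i : ℝ) + 1) * hermiteTensor (k + Pi.single i 1) x := by
    rw [fderiv_hermiteTensor_single, sqrt_mul_hermiteTensor_add_single]
  have hparts := h.integral_grad_mul_gaussianMeasure (contDiff_hermiteTensor k) i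
    (hw.integrable_mul (memLp_hermiteTensor k))
    (by simp only [hraise]; exact hw.integrable_mul ((memLp_hermiteTensor _).const_mul _))
    (hg.integrable_mul (memLp_hermiteTensor k))
  simpa only [hermiteCoeff, hraise, mul_left_comm (w _), integral_const_mul] using hparts

theorem gradient_hermiteTensor_apply (k : Fin d → ℕ) (x : EuclideanSpace ℝ (Fin d)) (i : Fin d) :
    gradient (hermiteTensor k) x i = √(k i : ℝ) * hermiteTensor (k - Pi.single i 1) x := by
  rw [gradient_apply, fderiv_hermiteTensor_single]

theorem memLp_gradient_hermiteTensor_apply (k : Fin d → ℕ) (i : Fin d) :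
    MemLp (fun x => gradient (hermiteTensor k) x i) 2 (gaussianMeasure d) := by
  simpa only [gradient_hermiteTensor_apply] using (memLp_hermiteTensor _).const_mul _

theorem hasWeakGradient_hermiteTensor (k : Fin d → ℕ) :
    HasWeakGradient (hermiteTensor k) (gradient (hermiteTensor k)) :=
  .of_contDiff ((contDiff_hermiteTensor k).of_le (by simp))

theorem sqrt_mul_hermiteCoeff_hermiteTensor_add_single (k l : Fin d → ℕ) (i : Fin d) :
    √((l i : ℝ) + 1) * hermiteCoeff (hermiteTensor k) (l + Pi.single i 1) =
      √(k i : ℝ) * hermiteCoeff (hermiteTensor (k - Pi.single i 1)) l := by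
  rw [← (hasWeakGradient_hermiteTensor k).hermiteCoeff_grad (memLp_hermiteTensor k)
    (memLp_gradient_hermiteTensor_apply k i) l]
  simp only [hermiteCoeff, gradient_hermiteTensor_apply, mul_assoc, integral_const_mul]

theorem hermiteCoeff_hermiteTensor_zero_right (k : Fin d → ℕ) :
    hermiteCoeff (hermiteTensor k) 0 = if k = 0 then 1 else 0 := by
  split_ifs with hk
  · simp [hermiteCoeff_zero_right, hk, hermiteTensor_zero]
  · obtain ⟨i, hi⟩ := Function.ne_iff.1 hk
    obtain ⟨m, rfl⟩ := exists_eq_add_single_of_ne_zero hi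
    have h := sqrt_mul_hermiteCoeff_hermiteTensor_add_single 0 m i
    have hcomm : hermiteCoeff (hermiteTensor 0) (m + Pi.single i 1) =
        hermiteCoeff (hermiteTensor (m + Pi.single i 1)) 0 := by
      simp only [hermiteCoeff, mul_comm]
    rw [Pi.zero_apply, Nat.cast_zero, Real.sqrt_zero, zero_mul, hcomm] at h
    exact (mul_eq_zero.1 h).resolve_left (by positivity)

theorem hermiteCoeff_hermiteTensor (k l : Fin d → ℕ) :
    hermiteCoeff (hermiteTensor k) l = if k = l then 1 else 0 := by
  induction l using multiIndex_induction generalizing k with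
  | zero => exact hermiteCoeff_hermiteTensor_zero_right k
  | add_single l i ih =>
    have h := sqrt_mul_hermiteCoeff_hermiteTensor_add_single k l i
    have hsqrt : √((l i : ℝ) + 1) ≠ 0 := by positivity
    rw [ih] at h
    refine mul_left_cancel₀ hsqrt (h.trans ?_)
    by_cases hki : k i = 0
    · have hne : k ≠ l + Pi.single i 1 := fun hk => by simp [hk] at hki
      simp [hki, hne]
    · obtain ⟨m, rfl⟩ := exists_eq_add_single_of_ne_zero hki
      simp only [add_tsub_cancel_right, add_left_inj]
      split_ifs with hml <;> simp [hml]

theorem hermiteCoeff_const (c : ℝ) (k : Fin d → ℕ) :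
    hermiteCoeff (fun _ => c) k = if k = 0 then c else 0 := by
  calc hermiteCoeff (fun _ => c) k = c * hermiteCoeff (hermiteTensor k) 0 := by
        rw [hermiteCoeff_zero_right, hermiteCoeff, integral_const_mul]
    _ = if k = 0 then c else 0 := by rw [hermiteCoeff_hermiteTensor, mul_ite, mul_one, mul_zero]

theorem hermiteCoeff_add_const (hf : MemLp f 2 (gaussianMeasure d)) (c : ℝ) (k : Fin d → ℕ) :
    hermiteCoeff (fun x => f x + c) k = hermiteCoeff f k + if k = 0 then c else 0 := by
  rw [← hermiteCoeff_const]
  simp only [hermiteCoeff, add_mul]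
  exact integral_add (hf.integrable_mul (memLp_hermiteTensor k))
    ((memLp_const (p := 2) c).integrable_mul (memLp_hermiteTensor k))

end HermiteCoefficients

section FourierUniqueness

theorem integral_mul_cexp_eq_zero_of_integral_mul_pow_eq_zero {α : Type*} [MeasurableSpace α]
    {μ : Measure α} {f u : α → ℝ} (hf : AEStronglyMeasurable f μ) (hu : AEStronglyMeasurable u μ)
    (hint : Integrable (fun x => f x * Real.exp |u x|) μ) (h : ∀ n : ℕ, ∫ x, f x * u x ^ n ∂μ = 0) :
    ∫ x, (f x : ℂ) * Complex.exp (u x * Complex.I) ∂μ = 0 := by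
  have hzero (n : ℕ) :
      ∫ x, (f x : ℂ) * ((n.factorial : ℂ)⁻¹ * (u x * Complex.I) ^ n) ∂μ = 0 := by
    calc ∫ x, (f x : ℂ) * ((n.factorial : ℂ)⁻¹ * (u x * Complex.I) ^ n) ∂μ
        = ∫ x, ((n.factorial : ℂ)⁻¹ * Complex.I ^ n) * ((f x * u x ^ n : ℝ) : ℂ) ∂μ := by
          refine integral_congr_ae (.of_forall fun x => ?_)
          push_cast
          ring
      _ = 0 := by rw [integral_const_mul, integral_complex_ofReal, h, Complex.ofReal_zero, mul_zero]
  have hexp (x : α) : HasSum (fun n : ℕ => ‖f x‖ * ((n.factorial : ℝ)⁻¹ * |u x| ^ n))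
      ‖f x * Real.exp |u x|‖ := by
    rw [norm_mul, Real.norm_of_nonneg (Real.exp_pos _).le, Real.exp_eq_exp_ℝ]
    exact (by simpa using NormedSpace.exp_series_hasSum_exp' (𝕂 := ℝ) |u x| : HasSum _ _).mul_left _
  suffices hsum : HasSum
      (fun n : ℕ => ∫ x, (f x : ℂ) * ((n.factorial : ℂ)⁻¹ * (u x * Complex.I) ^ n) ∂μ)
      (∫ x, (f x : ℂ) * Complex.exp (u x * Complex.I) ∂μ) by
    simp only [hzero] at hsum
    exact hsum.unique hasSum_zero
  refine hasSum_integral_of_dominated_convergence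
    (fun n x => ‖f x‖ * ((n.factorial : ℝ)⁻¹ * |u x| ^ n)) (fun n => ?_)
    (fun n => .of_forall fun x => ?_) (.of_forall fun x => (hexp x).summable) ?_
    (.of_forall fun x => ?_)
  · have hu' := Complex.continuous_ofReal.comp_aestronglyMeasurable hu
    exact (Complex.continuous_ofReal.comp_aestronglyMeasurable hf).mul
      (((hu'.mul_const _).pow n).const_mul _)
  · simp
  · simpa only [(hexp _).tsum_eq] using hint.norm
  · rw [Complex.exp_eq_exp_ℂ]
    exact (by simpa using NormedSpace.exp_series_hasSum_exp' (𝕂 := ℂ) (u x * Complex.I) :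
      HasSum _ _).mul_left _

variable {E : Type*} [NormedAddCommGroup E] [InnerProductSpace ℝ E] [MeasurableSpace E]
  {μ : Measure E} {f : E → ℝ}

theorem charFun_withDensity_ofReal (hf : AEMeasurable f μ) (ξ : E) :
    charFun (μ.withDensity fun x => ENNReal.ofReal (f x)) ξ =
      ∫ x, ((max (f x) 0 : ℝ) : ℂ) * Complex.exp (inner ℝ x ξ * Complex.I) ∂μ := by
  rw [charFun_apply, integral_withDensity_eq_integral_toReal_smul₀ hf.ennreal_ofReal (by simp)]
  simp only [ENNReal.toReal_ofReal', Complex.real_smul]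

theorem integrable_mul_cexp_inner [BorelSpace E] (hf : Integrable f μ) (ξ : E) :
    Integrable (fun x => (f x : ℂ) * Complex.exp (inner ℝ x ξ * Complex.I)) μ :=
  hf.ofReal.mul_bdd (c := 1) (Continuous.aestronglyMeasurable (by fun_prop))
    (.of_forall fun x => (Complex.norm_exp_ofReal_mul_I _).le)

/- The positive and negative parts of `f` are the densities of two finite measures with the same
characteristic function. -/
theorem ae_eq_zero_of_integral_mul_cexp_inner_eq_zero [BorelSpace E]
    [SecondCountableTopology E] [CompleteSpace E] (hf : Integrable f μ)
    (h : ∀ ξ, ∫ x, (f x : ℂ) * Complex.exp (inner ℝ x ξ * Complex.I) ∂μ = 0) : f =ᵐ[μ] 0 := by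
  have hpos : IsFiniteMeasure (μ.withDensity fun x => ENNReal.ofReal (f x)) :=
    isFiniteMeasure_withDensity_ofReal hf.2
  have hneg : IsFiniteMeasure (μ.withDensity fun x => ENNReal.ofReal (-f x)) :=
    isFiniteMeasure_withDensity_ofReal hf.neg.2
  have heq : (μ.withDensity fun x => ENNReal.ofReal (f x)) =
      μ.withDensity fun x => ENNReal.ofReal (-f x) := by
    refine Measure.ext_of_charFun (funext fun ξ => ?_)
    rw [charFun_withDensity_ofReal hf.aemeasurable,
      charFun_withDensity_ofReal (f := fun x => -f x) hf.aemeasurable.neg,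
      ← sub_eq_zero, ← integral_sub (integrable_mul_cexp_inner hf.pos_part ξ)
        (integrable_mul_cexp_inner hf.neg_part ξ), ← h ξ]
    simp only [← sub_mul, ← Complex.ofReal_sub, max_zero_sub_max_neg_zero_eq_self]
  have hae := (withDensity_eq_iff hf.aemeasurable.ennreal_ofReal
    hf.aemeasurable.neg.ennreal_ofReal hf.lintegral_lt_top.ne).1 heq
  filter_upwards [hae] with x hx
  have hmax : max (f x) 0 = max (-f x) 0 := by
    simpa only [ENNReal.toReal_ofReal', Pi.neg_apply] using congrArg ENNReal.toReal hx
  rw [← max_zero_sub_max_neg_zero_eq_self (f x), hmax, sub_self, Pi.zero_apply]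

end FourierUniqueness

section HermiteBasis

variable {d : ℕ} {f : EuclideanSpace ℝ (Fin d) → ℝ}

theorem inner_mul_hermiteTensor (k : Fin d → ℕ) (x ξ : EuclideanSpace ℝ (Fin d)) :
    inner ℝ x ξ * hermiteTensor k x = ∑ i, ξ i * (√((k i : ℝ) + 1) *
      hermiteTensor (k + Pi.single i 1) x + √(k i : ℝ) * hermiteTensor (k - Pi.single i 1) x) := by
  simp only [sqrt_mul_hermiteTensor_add_single, sub_add_cancel, ← mul_assoc, ← Finset.sum_mul]
  simp [PiLp.inner_apply]

theorem integral_mul_inner_pow_mul_hermiteTensor_eq_zero (hf : MemLp f 2 (gaussianMeasure d))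
    (h : ∀ k, hermiteCoeff f k = 0) (ξ : EuclideanSpace ℝ (Fin d)) (n : ℕ) (k : Fin d → ℕ) :
    ∫ x, f x * (inner ℝ x ξ ^ n * hermiteTensor k x) ∂(gaussianMeasure d) = 0 := by
  have hint (n : ℕ) (k : Fin d → ℕ) :
      Integrable (fun x => f x * (inner ℝ x ξ ^ n * hermiteTensor k x)) (gaussianMeasure d) := by
    refine hf.integrable_mul (memLp_of_hasTemperateGrowth (p := 2) ?_ (by simp))
    have := hasTemperateGrowth_hermiteTensor k
    fun_prop
  induction n generalizing k with
  | zero => simpa [hermiteCoeff] using h k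
  | succ n ih =>
    have hexpand (x : EuclideanSpace ℝ (Fin d)) :
        f x * (inner ℝ x ξ ^ (n + 1) * hermiteTensor k x) = ∑ i,
          (ξ i * √((k i : ℝ) + 1) *
              (f x * (inner ℝ x ξ ^ n * hermiteTensor (k + Pi.single i 1) x)) +
            ξ i * √(k i : ℝ) *
              (f x * (inner ℝ x ξ ^ n * hermiteTensor (k - Pi.single i 1) x))) := by
      rw [pow_succ, mul_assoc, inner_mul_hermiteTensor, Finset.mul_sum, Finset.mul_sum]
      exact Finset.sum_congr rfl fun i _ => by ring
    simp only [hexpand]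
    rw [integral_finsetSum _ fun i _ => by
      exact ((hint n _).const_mul _).add ((hint n _).const_mul _)]
    refine Finset.sum_eq_zero fun i _ => ?_
    rw [integral_add ((hint n _).const_mul _) ((hint n _).const_mul _), integral_const_mul,
      integral_const_mul, ih, ih, mul_zero, mul_zero, add_zero]

theorem ae_eq_zero_of_hermiteCoeff_eq_zero (hf : MemLp f 2 (gaussianMeasure d))
    (h : ∀ k, hermiteCoeff f k = 0) : f =ᵐ[gaussianMeasure d] 0 := by
  refine ae_eq_zero_of_integral_mul_cexp_inner_eq_zero (hf.integrable one_le_two) fun ξ => ?_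
  refine integral_mul_cexp_eq_zero_of_integral_mul_pow_eq_zero hf.1
    (Continuous.aestronglyMeasurable (by fun_prop)) ?_ fun n => ?_
  · have hexp : MemLp (fun x => Real.exp |inner ℝ x ξ|) 2 (gaussianMeasure d) := by
      simpa [real_inner_comm] using memLp_two_exp_abs_strongDual (innerSL ℝ ξ)
    exact hf.integrable_mul hexp
  · simpa [hermiteTensor_zero] using integral_mul_inner_pow_mul_hermiteTensor_eq_zero hf h ξ n 0

theorem inner_toLp_hermiteTensor (hf : MemLp f 2 (gaussianMeasure d)) (k : Fin d → ℕ) :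
    inner ℝ ((memLp_hermiteTensor k).toLp (hermiteTensor k)) (hf.toLp f) = hermiteCoeff f k := by
  rw [L2.inner_def]
  refine integral_congr_ae ?_
  filter_upwards [(memLp_hermiteTensor k).coeFn_toLp, hf.coeFn_toLp] with x hk hx
  rw [hk, hx]
  simp

theorem orthonormal_toLp_hermiteTensor :
    Orthonormal ℝ fun k : Fin d → ℕ => (memLp_hermiteTensor k).toLp (hermiteTensor k) := by
  classical
  rw [orthonormal_iff_ite]
  intro k l
  rw [inner_toLp_hermiteTensor, hermiteCoeff_hermiteTensor]
  simp only [eq_comm]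

theorem orthogonal_span_toLp_hermiteTensor_eq_bot :
    (Submodule.span ℝ (Set.range fun k : Fin d → ℕ =>
      (memLp_hermiteTensor k).toLp (hermiteTensor k)))ᗮ = ⊥ := by
  refine (Submodule.eq_bot_iff _).2 fun f hf => Lp.eq_zero_iff_ae_eq_zero.2 ?_
  refine ae_eq_zero_of_hermiteCoeff_eq_zero (Lp.memLp f) fun k => ?_
  rw [← inner_toLp_hermiteTensor (Lp.memLp f), Lp.toLp_coeFn]
  exact (Submodule.mem_orthogonal _ _).1 hf _ (Submodule.subset_span ⟨k, rfl⟩)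

/-- The Hermite tensors as a Hilbert basis of `L²` of the Gaussian measure. -/
noncomputable def hermiteBasis (d : ℕ) :
    HilbertBasis (Fin d → ℕ) ℝ (Lp ℝ 2 (gaussianMeasure d)) :=
  .mkOfOrthogonalEqBot orthonormal_toLp_hermiteTensor orthogonal_span_toLp_hermiteTensor_eq_bot

theorem eLpNorm_sq_eq_tsum_hermiteCoeff (hf : MemLp f 2 (gaussianMeasure d)) :
    eLpNorm f 2 (gaussianMeasure d) ^ 2 = ∑' k, ENNReal.ofReal (hermiteCoeff f k ^ 2) := by
  have hsum := (hermiteBasis d).hasSum_inner_mul_inner (hf.toLp f) (hf.toLp f)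
  have hcoeff (k : Fin d → ℕ) : inner ℝ (hermiteBasis d k) (hf.toLp f) = hermiteCoeff f k := by
    rw [hermiteBasis, HilbertBasis.coe_mkOfOrthogonalEqBot, inner_toLp_hermiteTensor]
  simp only [real_inner_comm (hermiteBasis d _), hcoeff, ← sq, real_inner_self_eq_norm_sq] at hsum
  rw [← ENNReal.ofReal_tsum_of_nonneg (fun k => sq_nonneg _) hsum.summable, hsum.tsum_eq,
    Lp.norm_toLp, ENNReal.ofReal_pow ENNReal.toReal_nonneg, ENNReal.ofReal_toReal hf.2.ne]

end HermiteBasis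

section Poincare

theorem eLpNorm_two_sq_eq_lintegral {α F : Type*} [MeasurableSpace α] [NormedAddCommGroup F]
    (f : α → F) (μ : Measure α) : eLpNorm f 2 μ ^ 2 = ∫⁻ x, ‖f x‖ₑ ^ 2 ∂μ := by
  simpa using eLpNorm_nnreal_pow_eq_lintegral (μ := μ) (f := f) (p := 2) two_ne_zero

theorem eLpNorm_sq_eq_sum_eLpNorm_apply_sq {α ι : Type*} [MeasurableSpace α] [Fintype ι]
    {μ : Measure α} {g : α → EuclideanSpace ℝ ι} (hg : AEStronglyMeasurable g μ) :
    eLpNorm g 2 μ ^ 2 = ∑ i, eLpNorm (fun x => g x i) 2 μ ^ 2 := by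
  have hgi (i : ι) : AEStronglyMeasurable (fun x => g x i) μ :=
    (EuclideanSpace.proj (𝕜 := ℝ) i).continuous.comp_aestronglyMeasurable hg
  simp only [eLpNorm_two_sq_eq_lintegral]
  rw [← lintegral_finsetSum' _ fun i _ => (hgi i).enorm.pow_const 2]
  refine lintegral_congr fun x => ?_
  simp only [← ofReal_norm, ← ENNReal.ofReal_pow (norm_nonneg _)]
  rw [EuclideanSpace.norm_sq_eq, ENNReal.ofReal_sum_of_nonneg fun i _ => sq_nonneg _]

variable {d : ℕ} {w : EuclideanSpace ℝ (Fin d) → ℝ}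
  {g : EuclideanSpace ℝ (Fin d) → EuclideanSpace ℝ (Fin d)}

theorem HasWeakGradient.aestronglyMeasurable_grad (h : HasWeakGradient w g) :
    AEStronglyMeasurable g (gaussianMeasure d) :=
  h.locallyIntegrable_grad.aestronglyMeasurable.mono_ac gaussianMeasure_absolutelyContinuous

theorem HasWeakGradient.eLpNorm_grad_apply_sq_eq_tsum (h : HasWeakGradient w g)
    (hw : MemLp w 2 (gaussianMeasure d)) {i : Fin d}
    (hg : MemLp (fun x => g x i) 2 (gaussianMeasure d)) :
    eLpNorm (fun x => g x i) 2 (gaussianMeasure d) ^ 2 =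
      ∑' k : Fin d → ℕ, ENNReal.ofReal (k i * hermiteCoeff w k ^ 2) := by
  have hshift := tsum_add_single_eq_tsum i
    (F := fun k => ENNReal.ofReal (k i * hermiteCoeff w k ^ 2)) fun k hk => by simp [hk]
  rw [eLpNorm_sq_eq_tsum_hermiteCoeff hg, ← hshift]
  refine tsum_congr fun k => ?_
  rw [h.hermiteCoeff_grad hw hg, mul_pow, Real.sq_sqrt (by positivity)]
  simp

theorem HasWeakGradient.eLpNorm_grad_sq_eq_tsum (h : HasWeakGradient w g)
    (hw : MemLp w 2 (gaussianMeasure d))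
    (hg : ∀ i, MemLp (fun x => g x i) 2 (gaussianMeasure d)) :
    eLpNorm g 2 (gaussianMeasure d) ^ 2 =
      ∑' k : Fin d → ℕ, ENNReal.ofReal ((∑ i, k i : ℕ) * hermiteCoeff w k ^ 2) := by
  simp only [eLpNorm_sq_eq_sum_eLpNorm_apply_sq h.aestronglyMeasurable_grad,
    h.eLpNorm_grad_apply_sq_eq_tsum hw (hg _)]
  rw [← Summable.tsum_finsetSum fun i _ => ENNReal.summable]
  refine tsum_congr fun k => ?_
  rw [← ENNReal.ofReal_sum_of_nonneg fun i _ => by positivity, ← Finset.sum_mul, Nat.cast_sum]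

theorem natCast_mul_hermiteCoeff_sub_integral_sq_le {n : ℕ} (hw : MemLp w 2 (gaussianMeasure d))
    (horth : ∀ k : Fin d → ℕ, 0 < ∑ j, k j → ∑ j, k j < n → hermiteCoeff w k = 0)
    (k : Fin d → ℕ) :
    n * hermiteCoeff (fun x => w x - ∫ y, w y ∂(gaussianMeasure d)) k ^ 2 ≤
      (∑ j, k j : ℕ) * hermiteCoeff w k ^ 2 := by
  simp only [sub_eq_add_neg, hermiteCoeff_add_const hw]
  obtain rfl | hk := eq_or_ne k 0
  · simp [hermiteCoeff_zero_right]
  rw [if_neg hk, add_zero]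
  obtain hkn | hkn := lt_or_ge (∑ j, k j) n
  · obtain ⟨i, hi⟩ := Function.ne_iff.1 hk
    have hpos : 0 < ∑ j, k j :=
      Finset.sum_pos' (fun j _ => Nat.zero_le _) ⟨i, Finset.mem_univ i, Nat.pos_of_ne_zero hi⟩
    simp [horth k hpos hkn]
  · gcongr

theorem HasWeakGradient.natCast_mul_eLpNorm_sub_integral_sq_le {n : ℕ} (h : HasWeakGradient w g)
    (hw : MemLp w 2 (gaussianMeasure d))
    (horth : ∀ k : Fin d → ℕ, 0 < ∑ j, k j → ∑ j, k j < n → hermiteCoeff w k = 0) :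
    n * eLpNorm (fun x => w x - ∫ y, w y ∂(gaussianMeasure d)) 2 (gaussianMeasure d) ^ 2 ≤
      eLpNorm g 2 (gaussianMeasure d) ^ 2 := by
  by_cases hg : eLpNorm g 2 (gaussianMeasure d) = ⊤
  · simp [hg]
  have hmem : MemLp g 2 (gaussianMeasure d) :=
    ⟨h.aestronglyMeasurable_grad, lt_top_iff_ne_top.2 hg⟩
  have hsub : MemLp (fun x => w x - ∫ y, w y ∂(gaussianMeasure d)) 2 (gaussianMeasure d) :=
    hw.sub (memLp_const _)
  rw [h.eLpNorm_grad_sq_eq_tsum hw fun i => (EuclideanSpace.proj (𝕜 := ℝ) i).comp_memLp' hmem,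
    eLpNorm_sq_eq_tsum_hermiteCoeff hsub, ← ENNReal.tsum_mul_left]
  refine ENNReal.tsum_le_tsum fun k => ?_
  rw [← ENNReal.ofReal_natCast, ← ENNReal.ofReal_mul (by positivity)]
  exact ENNReal.ofReal_le_ofReal (natCast_mul_hermiteCoeff_sub_integral_sq_le hw horth k)

theorem eLpNorm_hermiteTensor_sq (k : Fin d → ℕ) :
    eLpNorm (hermiteTensor k) 2 (gaussianMeasure d) ^ 2 = 1 := by
  rw [eLpNorm_sq_eq_tsum_hermiteCoeff (memLp_hermiteTensor k), tsum_eq_single k] <;>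
    simp +contextual [hermiteCoeff_hermiteTensor, eq_comm]

theorem eLpNorm_gradient_hermiteTensor_sq (k : Fin d → ℕ) :
    eLpNorm (gradient (hermiteTensor k)) 2 (gaussianMeasure d) ^ 2 = (∑ i, k i : ℕ) := by
  rw [(hasWeakGradient_hermiteTensor k).eLpNorm_grad_sq_eq_tsum (memLp_hermiteTensor k)
    (memLp_gradient_hermiteTensor_apply k), tsum_eq_single k]
  · rw [hermiteCoeff_hermiteTensor, if_pos rfl, one_pow, mul_one, ENNReal.ofReal_natCast]
  · simp +contextual [hermiteCoeff_hermiteTensor, eq_comm]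

theorem hasWeakGradient_hermiteTensor_add_const (k : Fin d → ℕ) (c : ℝ) :
    HasWeakGradient (fun x => hermiteTensor k x + c) (gradient (hermiteTensor k)) := by
  have hgrad : gradient (fun x => hermiteTensor k x + c) = gradient (hermiteTensor k) :=
    funext fun x => by rw [gradient, gradient, fderiv_add_const]
  rw [← hgrad]
  exact .of_contDiff (((contDiff_hermiteTensor k).of_le (by simp)).add contDiff_const)

end Poincare

theorem proposition1 (d n : ℕ) (hd : 0 < d) (hn : 0 < n) :
    IsLeast
      {C : ℝ≥0 |
        ∀ (w : EuclideanSpace ℝ (Fin d) → ℝ)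
          (g : EuclideanSpace ℝ (Fin d) → EuclideanSpace ℝ (Fin d)),
          MemLp w 2 (gaussianMeasure d) →
          HasWeakGradient w g →
          ∫ x, w x ∂(gaussianMeasure d) = 1 →
          (∀ k : Fin d → ℕ, 0 < ∑ j, k j → ∑ j, k j < n →
            ∫ x, w x * hermiteTensor k x ∂(gaussianMeasure d) = 0) →
          eLpNorm (fun x => w x - 1) 2 (gaussianMeasure d) ^ 2 ≤
            (C : ℝ≥0∞) * eLpNorm g 2 (gaussianMeasure d) ^ 2}
      (1 / (n : ℝ≥0)) := by
  refine ⟨fun w g hw h h1 horth => ?_, fun C hC => ?_⟩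
  · have hpoincare := h.natCast_mul_eLpNorm_sub_integral_sq_le hw horth
    rw [h1, ENNReal.mul_le_iff_le_inv (by simpa using hn.ne') (by simp)] at hpoincare
    simpa [ENNReal.coe_inv, hn.ne'] using hpoincare
  · let k : Fin d → ℕ := Pi.single ⟨0, hd⟩ n
    have hkn : ∑ i, k i = n := by simp [k]
    have hk0 : k ≠ 0 := fun hk => hn.ne (by simp [← hkn, hk])
    have hcoeff := hermiteCoeff_add_const (memLp_hermiteTensor k) 1
    have hsharp := hC (fun x => hermiteTensor k x + 1) _
      ((memLp_hermiteTensor k).add (memLp_const 1)) (hasWeakGradient_hermiteTensor_add_const k 1) ?_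
      fun l hl hln => ?_
    · simp only [add_sub_cancel_right] at hsharp
      rw [eLpNorm_hermiteTensor_sq, eLpNorm_gradient_hermiteTensor_sq, hkn] at hsharp
      exact (div_le_iff₀ (by positivity)).2 (by exact_mod_cast hsharp)
    · exact (hermiteCoeff_zero_right _).symm.trans <| by
        simp [hcoeff, hermiteCoeff_hermiteTensor, hk0]
    · have hl0 : l ≠ 0 := by rintro rfl; simp at hl
      have hkl : k ≠ l := by rintro rfl; exact hln.ne hkn
      exact (hcoeff l).trans (by simp [hermiteCoeff_hermiteTensor, hl0, hkl])
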